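/- All Hilbert spaces are finite-dimensional and non-zero, and $\log$ is the logarithm in base two (with $\log 0=-\infty$, $\inf\emptyset=+\infty$). A quantum channel is a completely positive trace-preserving (CPTP) linear map between operator spaces; $\|X\|_1=\operatorname{tr}\sqrt{X^\dagger X}$ and $\|\mathcal F\|_\diamond=\sup_{k\in\mathbb N}\sup_{\|X\|_1\le 1}\|(\mathcal F\otimes \mathrm{id}_k)(X)\|_1$. A no-signalling-assisted code is a quantum channel $\Pi_{A_iB_i\to A_oB_o}$ such that $\operatorname{tr}_{A_o}\Pi(\rho_1\otimes\sigma)=\operatorname{tr}_{A_o}\Pi(\rho_2\otimes\sigma)$ for all states $\rho_1,\rho_2$ on $A_i$ and operators $\sigma$ on $B_i$, and $\operatorname{tr}_{B_o}\Pi(\sigma\otimes\rho_1)=\operatorname{tr}_{B_o}\Pi(\sigma\otimes\rho_2)$ for all operators $\sigma$ on $A_i$ and states $\rho_1,\rho_2$ on $B_i$. For a channel $\mathcal M_{A_o\to B_i}$, let $\Pi\circ\mathcal M$ be the map from $A_i$ to $B_o$ obtained by feeding the output $A_o$ of $\Pi$ into $\mathcal M$ and the output of $\mathcal M$ into the input $B_i$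 of $\Pi$, that is, in orthonormal bases $\{|a\rangle\}$ of $A_o$ and $\{|b\rangle\}$ of $B_i$, $$(\Pi\circ\mathcal M)(X)=\sum_{a,a',b,b'}\langle b|\mathcal M(|a\rangle\langle a'|)|b'\rangle\;\langle a|_{A_o}\,\Pi(X\otimes|b\rangle\langle b'|)\,|a'\rangle_{A_o}.$$ For a channel $\mathcal N$ from $A'$ to $B$ and $\varepsilon\ge 0$, the one-shot $\varepsilon$-error quantum simulation cost of $\mathcal N$ under no-signalling-assisted codes is $$S^{(1)}_{\mathrm{NS},\varepsilon}(\mathcal N)=\log\inf\Big\{m\in\mathbb N,\ m\ge 1\ \Big|\ \tfrac12\inf_{\Pi}\|\Pi\circ\mathrm{id}_m-\mathcal N\|_\diamond\le\varepsilon\Big\},$$ where $\mathrm{id}_m$ is the noiseless channel of dimension $m$ and $\Pi$ ranges over the no-signalling-assisted codes with $A_i=A'$, $B_o=B$ and $A_o$, $B_i$ of dimension $m$. For positive semidefinite $\rho,\sigma$ let $D_{\max}(\rho\|\sigma)=\inf\{t\in\mathbb R\mid\rho\le 2^t\sigma\}$; for a state $\rho_{AB}$ let $I_{\max}(A:B)_\rho=\inf_{\sigma_B}D_{\max}(\rho_{AB}\|\rho_A\otimes\sigma_B)$,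 the infimum being over all states $\sigma_B$; for a channel $\mathcal N_{A'\to B}$ let $I_{\max}(A:B)_{\mathcal N}=I_{\max}(A:B)_{\mathcal N_{A'\to B}(\Phi_{AA'})}$, where $\Phi_{AA'}=\frac1{|A|}\sum_{i,j}|i\,i\rangle\langle j\,j|$ is the maximally entangled state; and let $$I^\varepsilon_{\max}(A:B)_{\mathcal N}=\inf\Big\{I_{\max}(A:B)_{\widetilde{\mathcal N}}\ \Big|\ \widetilde{\mathcal N}\in\mathrm{CPTP}(A':B),\ \tfrac12\|\widetilde{\mathcal N}-\mathcal N\|_\diamond\le\varepsilon\Big\}.$$ Theorem. For every quantum channel $\mathcal N$ from $A'$ to $B$ and every $\varepsilon\ge 0$, $$S^{(1)}_{\mathrm{NS},\varepsilon}(\mathcal N)=\tfrac12 I^\varepsilon_{\max}(A:B)_{\mathcal N}+\delta,$$ where $\delta$ is the least number in $[0,1]$ for which the right-hand side is the logarithm of a positive integer; in particular such a $\delta$ exists. -/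

import Mathlib

namespace QuantumSimulation

open scoped ComplexOrder MatrixOrder Kronecker ENNReal NNReal

noncomputable section

/-! Operators on a finite-dimensional Hilbert space with orthonormal basis indexed by `A`
are the matrices `Matrix A A ℂ`; `A × B` indexes the basis of a bipartite system. -/

/-- The partial trace over the first tensor factor. -/
def traceFst {A B : Type*} [Fintype A] (X : Matrix (A × B) (A × B) ℂ) : Matrix B B ℂ :=
  Matrix.of fun b b' => ∑ a, X (a, b) (a, b')

/-- The partial trace over the second tensor factor. -/
def traceSnd {A B : Type*} [Fintype B] (X : Matrix (A × B) (A × B) ℂ) : Matrix A A ℂ :=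
  Matrix.of fun a a' => ∑ b, X (a, b) (a', b)

/-- `(id_R ⊗ F)(X)`: the map `F` applied to the system `A` of an operator on `R ⊗ A`, where `R` is
a reference system on which nothing happens. -/
def applyWithReference (R : Type*) {A B : Type*}
    (F : Matrix A A ℂ →ₗ[ℂ] Matrix B B ℂ) (X : Matrix (R × A) (R × A) ℂ) :
    Matrix (R × B) (R × B) ℂ :=
  Matrix.of fun p q => F (Matrix.of fun a a' => X (p.1, a) (q.1, a')) p.2 q.2

/-- Complete positivity: `id_k ⊗ F` preserves positive semidefiniteness for every `k`. -/
def IsCompletelyPositive {A B : Type*} (F : Matrix A A ℂ →ₗ[ℂ] Matrix B B ℂ) : Prop :=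
  ∀ (k : ℕ) (X : Matrix (Fin k × A) (Fin k × A) ℂ),
    X.PosSemidef → (applyWithReference (Fin k) F X).PosSemidef

/-- Trace preservation. -/
def IsTracePreserving {A B : Type*} [Fintype A] [Fintype B]
    (F : Matrix A A ℂ →ₗ[ℂ] Matrix B B ℂ) : Prop :=
  ∀ X : Matrix A A ℂ, (F X).trace = X.trace

/-- Quantum channels: completely positive and trace-preserving linear maps. -/
structure IsChannel {A B : Type*} [Fintype A] [Fintype B]
    (F : Matrix A A ℂ →ₗ[ℂ] Matrix B B ℂ) : Prop where
  completelyPositive : IsCompletelyPositive F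
  tracePreserving : IsTracePreserving F

/-- Quantum states: positive semidefinite operators of trace one. -/
structure IsState {A : Type*} [Fintype A] (ρ : Matrix A A ℂ) : Prop where
  posSemidef : ρ.PosSemidef
  trace_eq_one : ρ.trace = 1

/-- The Schatten 1-norm `tr √(X† X)`. -/
def traceNorm {A : Type*} [Fintype A] [DecidableEq A] (X : Matrix A A ℂ) : ℝ :=
  (CFC.sqrt (X.conjTranspose * X)).trace.re

/-- The diamond norm: the supremum over `k` and over `X` with `‖X‖₁ ≤ 1` of
`‖(id_k ⊗ F)(X)‖₁`. -/
def diamondNorm {A B : Type*} [Fintype A] [DecidableEq A] [Fintype B] [DecidableEq B]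
    (F : Matrix A A ℂ →ₗ[ℂ] Matrix B B ℂ) : ℝ≥0∞ :=
  ⨆ (k : ℕ) (X : Matrix (Fin k × A) (Fin k × A) ℂ) (_ : traceNorm X ≤ 1),
    ENNReal.ofReal (traceNorm (applyWithReference (Fin k) F X))

/-! ### Codes and the one-shot simulation cost -/

/-- A no-signalling-assisted code: a bipartite quantum operation from `Ai ⊗ Bi` to `Ao ⊗ Bo` (Alice
holds `Ai`, `Ao` and Bob holds `Bi`, `Bo`) which is no-signalling in both directions. -/
structure IsNSCode {Ai Bi Ao Bo : Type*} [Fintype Ai] [Fintype Bi] [Fintype Ao] [Fintype Bo]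
    (P : Matrix (Ai × Bi) (Ai × Bi) ℂ →ₗ[ℂ] Matrix (Ao × Bo) (Ao × Bo) ℂ) : Prop where
  channel : IsChannel P
  noSignallingAliceToBob : ∀ (ρ₁ ρ₂ : Matrix Ai Ai ℂ) (σ : Matrix Bi Bi ℂ),
    IsState ρ₁ → IsState ρ₂ → traceFst (P (ρ₁ ⊗ₖ σ)) = traceFst (P (ρ₂ ⊗ₖ σ))
  noSignallingBobToAlice : ∀ (σ : Matrix Ai Ai ℂ) (ρ₁ ρ₂ : Matrix Bi Bi ℂ),
    IsState ρ₁ → IsState ρ₂ → traceSnd (P (σ ⊗ₖ ρ₁)) = traceSnd (P (σ ⊗ₖ ρ₂))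

/-- The effective map `P ∘ N` from `Ai` to `Bo`, obtained by feeding Alice's output `Ao` of `P` into
`N` and the output of `N` into Bob's input `Bi` of `P`. For `P = E ⊗ D` it is `D ∘ N ∘ E`. -/
def composeCode {Ai Bi Ao Bo : Type*} [Fintype Bi] [DecidableEq Bi]
    [Fintype Ao] [DecidableEq Ao]
    (P : Matrix (Ai × Bi) (Ai × Bi) ℂ →ₗ[ℂ] Matrix (Ao × Bo) (Ao × Bo) ℂ)
    (N : Matrix Ao Ao ℂ →ₗ[ℂ] Matrix Bi Bi ℂ) :
    Matrix Ai Ai ℂ →ₗ[ℂ] Matrix Bo Bo ℂ where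
  toFun X := Matrix.of fun o o' => ∑ a, ∑ a', ∑ b, ∑ b',
    N (Matrix.single a a' 1) b b' * P (X ⊗ₖ Matrix.single b b' 1) (a, o) (a', o')
  map_add' X Y := by
    ext o o'
    simp [Matrix.add_kronecker, mul_add, Finset.sum_add_distrib]
  map_smul' c X := by
    ext o o'
    simp [Matrix.smul_kronecker, Finset.mul_sum, mul_left_comm]

/-- The minimum error of simulation of `M` by `N` under no-signalling-assisted codes. -/
def simulationErrorNS {Ai Bi Ao Bo : Type*} [Fintype Ai] [DecidableEq Ai]
    [Fintype Bi] [DecidableEq Bi] [Fintype Ao] [DecidableEq Ao] [Fintype Bo] [DecidableEq Bo]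
    (N : Matrix Ao Ao ℂ →ₗ[ℂ] Matrix Bi Bi ℂ) (M : Matrix Ai Ai ℂ →ₗ[ℂ] Matrix Bo Bo ℂ) : ℝ≥0∞ :=
  (1 / 2) * ⨅ (P : Matrix (Ai × Bi) (Ai × Bi) ℂ →ₗ[ℂ] Matrix (Ao × Bo) (Ao × Bo) ℂ)
    (_ : IsNSCode P), diamondNorm (composeCode P N - M)

/-- The logarithm in base two, with `log2 0 = -∞` and `log2 ∞ = ∞`. -/
def log2 (x : ℝ≥0∞) : EReal := ENNReal.log x / ((Real.log 2 : ℝ) : EReal)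

/-- The one-shot `ε`-error quantum simulation cost under no-signalling-assisted codes: the
logarithm of the least dimension `m ≥ 1` of a noiseless channel `id_m` that simulates `N` with error
at most `ε`. -/
def simulationCostNS {A B : Type*} [Fintype A] [DecidableEq A] [Fintype B] [DecidableEq B]
    (ε : ℝ≥0) (N : Matrix A A ℂ →ₗ[ℂ] Matrix B B ℂ) : EReal :=
  log2 (⨅ (m : ℕ) (_ : 1 ≤ m ∧
    simulationErrorNS (LinearMap.id : Matrix (Fin m) (Fin m) ℂ →ₗ[ℂ] Matrix (Fin m) (Fin m) ℂ) N
      ≤ (ε : ℝ≥0∞)), (m : ℝ≥0∞))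

/-! ### The smooth max-information of a channel -/

/-- The max-relative entropy `inf {t | ρ ≤ 2^t σ}`, with `≤` the Loewner order. -/
def maxRelativeEntropy {A : Type*} (ρ σ : Matrix A A ℂ) : EReal :=
  ⨅ (t : ℝ) (_ : ρ ≤ ((2 : ℝ) ^ t) • σ), (t : EReal)

/-- The max-information that `B` has about `A` in `ρ`: the infimum of `D_max(ρ_AB ‖ ρ_A ⊗ σ_B)`
over the states `σ_B`. -/
def maxInformation {A B : Type*} [Fintype B] (ρ : Matrix (A × B) (A × B) ℂ) : EReal :=
  ⨅ (σ : Matrix B B ℂ) (_ : IsState σ), maxRelativeEntropy ρ (traceSnd ρ ⊗ₖ σ)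

/-- The maximally entangled state `|A|⁻¹ ∑ᵢⱼ |i i⟩⟨j j|`. -/
def maximallyEntangled (A : Type*) [Fintype A] [DecidableEq A] : Matrix (A × A) (A × A) ℂ :=
  (Fintype.card A : ℂ)⁻¹ •
    ∑ i : A, ∑ j : A, Matrix.single (i, i) (j, j) (1 : ℂ)

/-- The max-information of a channel: that of its Choi state. -/
def channelMaxInformation {A B : Type*} [Fintype A] [DecidableEq A] [Fintype B]
    (N : Matrix A A ℂ →ₗ[ℂ] Matrix B B ℂ) : EReal :=
  maxInformation (applyWithReference A N (maximallyEntangled A))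

/-- The smooth max-information of a channel: the infimum of the max-information over the channels
at half the diamond-norm distance at most `ε`. -/
def smoothChannelMaxInformation {A B : Type*} [Fintype A] [DecidableEq A]
    [Fintype B] [DecidableEq B] (ε : ℝ≥0) (N : Matrix A A ℂ →ₗ[ℂ] Matrix B B ℂ) : EReal :=
  ⨅ (N' : Matrix A A ℂ →ₗ[ℂ] Matrix B B ℂ)
    (_ : IsChannel N' ∧ (1 / 2) * diamondNorm (N' - N) ≤ (ε : ℝ≥0∞)), channelMaxInformation N'

end

end QuantumSimulation

namespace QuantumSimulation

open scoped ComplexOrder MatrixOrder Kronecker ENNReal NNReal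

noncomputable section

/-! ### Trace norm and compactness -/

/-! A channel has the form `Π ∘ id_m`, with `Π` a no-signalling code, exactly when its Choi matrix
`J` satisfies `J ≤ m² (1 ⊗ σ)` for some state `σ`. Necessity
(`IsNSCode.exists_choi_composeCode_id_le`) is Cauchy-Schwarz followed by no-signalling from Alice to
Bob, each costing a factor `m`. For sufficiency (`exists_isNSCode_composeCode_id_eq`) a code is
built by placing `J` on the maximally entangled projection of the `m × m` system and the normalised
remainder `m² (1 ⊗ σ) - J` on its complement.

The max-information of a channel is at most `s` under the same condition with `2 ^ s` in place of
`m²`. By compactness of `approximants` the infima are attained, so "error at most `ε`" and "smooth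
max-information at most `s`" both say that one such set is nonempty (`simulationErrorNS_id_le_iff`,
`smoothChannelMaxInformation_le_iff`).

Hence, writing `I` for the smooth max-information, `m` is feasible iff `2 ^ (I / 2) ≤ m`, and the
cost is the logarithm of the ceiling of `x = 2 ^ (I / 2)`. Since `x ≥ 1`, the ceiling is at most `2
* x`, so rounding costs at most one bit. -/

theorem isClosed_posSemidef {A : Type*} [Fintype A] :
    IsClosed {J : Matrix A A ℂ | J.PosSemidef} := by
  simp only [Matrix.posSemidef_iff_dotProduct_mulVec, Matrix.IsHermitian, Set.ofPred_and,
    Set.ofPred_forall]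
  refine (isClosed_eq (by fun_prop) continuous_id).inter (isClosed_iInter fun x => ?_)
  exact isClosed_le continuous_const (by unfold dotProduct Matrix.mulVec dotProduct; fun_prop)

section TraceNorm

open scoped Matrix.Norms.L2Operator

variable {A : Type*} [Fintype A] [DecidableEq A]

theorem continuous_traceNorm : Continuous (traceNorm : Matrix A A ℂ → ℝ) := by
  have h : Continuous fun X : Matrix A A ℂ => CFC.sqrt (X.conjTranspose * X) := by
    unfold CFC.sqrt
    refine Continuous.cfcₙ_nnreal_of_mem_nhdsSet (s := Set.univ) _ Filter.univ_mem ?_ ?_ ?_ ?_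
    · fun_prop
    · exact fun X => (Matrix.posSemidef_conjTranspose_mul_self X).nonneg
    · exact NNReal.continuous_sqrt.continuousOn
    · simp
  exact Complex.continuous_re.comp h.matrix_trace

theorem span_nonneg_matrix : Submodule.span ℂ {a : Matrix A A ℂ | 0 ≤ a} = ⊤ := by
  let _ : CStarAlgebra (Matrix A A ℂ) := {}
  exact CStarAlgebra.span_nonneg

/-- Each eigenvalue is at most the sum of all of them, as none is negative. -/
theorem le_algebraMap_trace {J : Matrix A A ℂ} (hJ : J.PosSemidef) :
    J ≤ algebraMap ℝ _ J.trace.re := by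
  refine le_algebraMap_of_spectrum_le ?_ hJ.1
  intro x hx
  rw [hJ.1.spectrum_real_eq_range_eigenvalues] at hx
  obtain ⟨i, rfl⟩ := hx
  rw [hJ.1.trace_eq_sum_eigenvalues]
  simpa using Finset.single_le_sum (f := hJ.1.eigenvalues) (fun i _ => hJ.eigenvalues_nonneg i)
    (Finset.mem_univ i)

theorem norm_le_trace {J : Matrix A A ℂ} (hJ : J.PosSemidef) : ‖J‖ ≤ J.trace.re := by
  let _ : CStarAlgebra (Matrix A A ℂ) := {}
  exact (CStarAlgebra.norm_le_iff_le_algebraMap J (Complex.nonneg_iff.1 hJ.trace_nonneg).1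
    hJ.nonneg).2 (le_algebraMap_trace hJ)

theorem isCompact_posSemidef_trace_eq (c : ℂ) :
    IsCompact {J : Matrix A A ℂ | J.PosSemidef ∧ J.trace = c} := by
  have : ProperSpace (Matrix A A ℂ) := FiniteDimensional.proper ℂ _
  refine (isCompact_closedBall (0 : Matrix A A ℂ) c.re).of_isClosed_subset ?_ ?_
  · exact isClosed_posSemidef.inter (isClosed_eq continuous_id.matrix_trace continuous_const)
  · rintro J ⟨h1, rfl⟩
    simpa using norm_le_trace h1

end TraceNorm

/-! ### Positive semidefinite matrices: sums over fibres -/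

section Fibre

variable {ι κ n : Type*} [Fintype ι] [Fintype κ]

/-- This is `Vᴴ M' V`, with `M'` the pullback of `M` along `f` to `ι × κ` and `V` carrying the
weights `w`. -/
theorem posSemidef_sum_sum {M : Matrix n n ℂ} (hM : M.PosSemidef) (f : ι → κ → n) (w : κ → ℂ) :
    (Matrix.of fun i j => ∑ k, ∑ l, star (w k) * M (f i k) (f j l) * w l).PosSemidef := by
  classical
  have h := (hM.submatrix fun p : ι × κ => f p.1 p.2).conjTranspose_mul_mul_same
    (Matrix.of fun (p : ι × κ) (j : ι) => if p.1 = j then w p.2 else 0)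
  convert h using 1
  ext i j
  simp only [Matrix.of_apply, Matrix.mul_apply, Matrix.conjTranspose_apply, Fintype.sum_prod_type,
    Matrix.submatrix_apply, Finset.sum_mul, apply_ite, ite_mul, mul_zero, zero_mul,
    star_zero]
  simp only [Finset.sum_ite_irrel, Finset.sum_const_zero, Finset.sum_ite_eq', Finset.mem_univ,
    if_true]
  exact Finset.sum_comm

theorem posSemidef_sum_fibre {M : Matrix n n ℂ} (hM : M.PosSemidef) (f : ι → κ → n) :
    (Matrix.of fun i j => ∑ k, ∑ l, M (f i k) (f j l)).PosSemidef := by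
  simpa using posSemidef_sum_sum hM f 1

omit [Fintype ι] in
theorem posSemidef_sum_diag {M : Matrix n n ℂ} (hM : M.PosSemidef) (f : ι → κ → n) :
    (Matrix.of fun i j => ∑ k, M (f i k) (f j k)).PosSemidef := by
  convert Matrix.posSemidef_sum Finset.univ fun k (_ : k ∈ Finset.univ) =>
    hM.submatrix fun i => f i k
  ext i j
  simp [Matrix.sum_apply]

/-- The Cauchy-Schwarz inequality for block sums. -/
theorem posSemidef_card_mul_sum_diag_sub {M : Matrix n n ℂ} (hM : M.PosSemidef) (f : ι → κ → n) :
    (Matrix.of fun i j => (Fintype.card κ : ℂ) * ∑ k, M (f i k) (f j k) -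
      ∑ k, ∑ l, M (f i k) (f j l)).PosSemidef := by
  -- The weights `1` on `k` and `-1` on `l` give the matrix analogue of `|v k - v l|² ≥ 0`; half the
  -- sum over all pairs is the claim.
  have h (k l : κ) : (Matrix.of fun i j => M (f i k) (f j k) - M (f i k) (f j l) -
      M (f i l) (f j k) + M (f i l) (f j l)).PosSemidef := by
    convert posSemidef_sum_sum hM (fun i (b : Bool) => f i (if b then k else l))
      (fun b => if b then 1 else -1) using 1
    ext i j
    simp
    ring
  have h2 := (Matrix.posSemidef_sum Finset.univ fun k (_ : k ∈ Finset.univ) =>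
    Matrix.posSemidef_sum Finset.univ fun l (_ : l ∈ Finset.univ) => h k l).smul
      (show (0 : ℂ) ≤ 1 / 2 by simp)
  convert h2 using 1
  ext i j
  simp only [Matrix.of_apply, Matrix.smul_apply, Matrix.sum_apply, Finset.sum_add_distrib,
    Finset.sum_sub_distrib, smul_eq_mul, Finset.sum_const, Finset.card_univ, nsmul_eq_mul,
    ← Finset.mul_sum]
  rw [Finset.sum_comm (f := fun k l => M (f i l) (f j k))]
  ring

end Fibre

section

/-! ### Choi matrices -/

variable {A B : Type*} [Fintype A] [DecidableEq A]

/-- The Choi matrix of a linear map. -/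
def choi (F : Matrix A A ℂ →ₗ[ℂ] Matrix B B ℂ) : Matrix (A × B) (A × B) ℂ :=
  Matrix.of fun p q => F (Matrix.single p.1 q.1 1) p.2 q.2

/-- The linear map with a given Choi matrix. -/
def ofChoi (J : Matrix (A × B) (A × B) ℂ) : Matrix A A ℂ →ₗ[ℂ] Matrix B B ℂ where
  toFun X := Matrix.of fun b b' => ∑ a, ∑ a', X a a' * J (a, b) (a', b')
  map_add' X Y := by
    ext
    simp [add_mul, Finset.sum_add_distrib]
  map_smul' c X := by
    ext
    simp [mul_assoc, Finset.mul_sum]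

omit [DecidableEq A] in
theorem ofChoi_apply (J : Matrix (A × B) (A × B) ℂ) (X : Matrix A A ℂ) (b b' : B) :
    ofChoi J X b b' = ∑ a, ∑ a', X a a' * J (a, b) (a', b') := rfl

theorem choi_ofChoi (J : Matrix (A × B) (A × B) ℂ) : choi (ofChoi J) = J := by
  ext ⟨a, b⟩ ⟨a', b'⟩
  simp [choi, ofChoi_apply, Matrix.single_apply, ite_and]

theorem ofChoi_choi (F : Matrix A A ℂ →ₗ[ℂ] Matrix B B ℂ) : ofChoi (choi F) = F := by
  refine LinearMap.ext fun X => ?_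
  ext b b'
  conv_rhs => rw [Matrix.matrix_eq_sum_single X]
  simp only [ofChoi_apply, choi, Matrix.of_apply, map_sum, Matrix.sum_apply]
  refine Finset.sum_congr rfl fun a _ => Finset.sum_congr rfl fun a' _ => ?_
  rw [← mul_one (X a a'), ← smul_eq_mul (X a a') 1, ← Matrix.smul_single, map_smul]
  simp

theorem apply_eq_sum_choi (F : Matrix A A ℂ →ₗ[ℂ] Matrix B B ℂ) (X : Matrix A A ℂ) (b b' : B) :
    F X b b' = ∑ a, ∑ a', X a a' * choi F (a, b) (a', b') := by
  conv_lhs => rw [← ofChoi_choi F]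
  rfl

omit [DecidableEq A] in
-- Applying the map to one half of `X` contracts the two `A` indices of `X ⊗ J`, which is a fibre
-- sum of a positive semidefinite matrix.
theorem isCompletelyPositive_ofChoi [Fintype B] {J : Matrix (A × B) (A × B) ℂ} (hJ : J.PosSemidef) :
    IsCompletelyPositive (ofChoi J) := by
  intro k X hX
  have := posSemidef_sum_fibre (hX.kronecker hJ)
    (fun (p : Fin k × B) (a : A) => ((p.1, a), (a, p.2)))
  exact this

theorem IsCompletelyPositive.posSemidef_choi {F : Matrix A A ℂ →ₗ[ℂ] Matrix B B ℂ}
    (hF : IsCompletelyPositive F) : (choi F).PosSemidef := by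
  -- Complete positivity only speaks of references `Fin k`, so the reference copy of `A` in the
  -- unnormalised maximally entangled vector is relabelled.
  have e := Fintype.equivFin A
  have h := (hF _ _ (Matrix.posSemidef_vecMulVec_self_star
    (fun p : Fin (Fintype.card A) × A => if p.1 = e p.2 then (1 : ℂ) else 0))).submatrix
    (fun p : A × B => (e p.1, p.2))
  convert h using 1
  ext ⟨a, b⟩ ⟨a', b'⟩
  simp only [choi, applyWithReference, Matrix.of_apply, Matrix.submatrix_apply]
  refine congrFun (congrFun (congrArg F ?_) b) b'
  ext i j
  by_cases hi : a = i <;> by_cases hj : a' = j <;>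
    simp [Matrix.vecMulVec_apply, hi, hj]

theorem isTracePreserving_iff [Fintype B] {F : Matrix A A ℂ →ₗ[ℂ] Matrix B B ℂ} :
    IsTracePreserving F ↔ traceSnd (choi F) = 1 := by
  constructor
  · intro h
    ext a a'
    have := h (Matrix.single a a' 1)
    simp only [traceSnd, choi, Matrix.of_apply, Matrix.one_apply]
    rw [Matrix.trace] at this
    simp only [Matrix.diag_apply] at this
    rw [this, Matrix.trace]
    simp [Matrix.single_apply, ite_and, eq_comm]
  · intro h X
    have h' (a a' : A) : ∑ b, choi F (a, b) (a', b) = if a = a' then 1 else 0 := by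
      simpa [traceSnd, Matrix.one_apply] using congrFun (congrFun h a) a'
    simp only [Matrix.trace, Matrix.diag_apply, apply_eq_sum_choi F]
    rw [Finset.sum_comm]
    refine Finset.sum_congr rfl fun a _ => ?_
    rw [Finset.sum_comm]
    simp [← Finset.mul_sum, h']

theorem isChannel_ofChoi [Fintype B] {J : Matrix (A × B) (A × B) ℂ} (hJ : J.PosSemidef)
    (h : traceSnd J = 1) : IsChannel (ofChoi J) :=
  ⟨isCompletelyPositive_ofChoi hJ, isTracePreserving_iff.2 (by rwa [choi_ofChoi])⟩

omit [Fintype A] [DecidableEq A] in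
theorem IsCompletelyPositive.posSemidef_apply {F : Matrix A A ℂ →ₗ[ℂ] Matrix B B ℂ}
    (hF : IsCompletelyPositive F) {X : Matrix A A ℂ} (hX : X.PosSemidef) : (F X).PosSemidef := by
  have h := (hF 1 _ (hX.submatrix Prod.snd)).submatrix (fun b => (0, b))
  exact h

theorem applyWithReference_maximallyEntangled (F : Matrix A A ℂ →ₗ[ℂ] Matrix B B ℂ) :
    applyWithReference A F (maximallyEntangled A) = (Fintype.card A : ℂ)⁻¹ • choi F := by
  ext ⟨a, b⟩ ⟨a', b'⟩
  have : (Matrix.of fun i j => maximallyEntangled A (a, i) (a', j)) =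
      (Fintype.card A : ℂ)⁻¹ • Matrix.single a a' (1 : ℂ) := by
    ext i j
    simp only [maximallyEntangled, Matrix.of_apply, Matrix.smul_apply, Matrix.sum_apply,
      Matrix.single_apply, Prod.mk.injEq]
    congr 1
    rw [Finset.sum_eq_single a, Finset.sum_eq_single a'] <;> aesop
  simp only [applyWithReference, Matrix.of_apply, this, map_smul]
  rfl

omit [Fintype A] [DecidableEq A] in
theorem applyWithReference_sub (R : Type*) (F G : Matrix A A ℂ →ₗ[ℂ] Matrix B B ℂ)
    (X : Matrix (R × A) (R × A) ℂ) : applyWithReference R (F - G) X =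
      applyWithReference R F X - applyWithReference R G X := rfl

omit [DecidableEq A] in
theorem trace_traceSnd [Fintype B] (X : Matrix (A × B) (A × B) ℂ) :
    (traceSnd X).trace = X.trace := by
  simp [traceSnd, Matrix.trace, Fintype.sum_prod_type]

omit [DecidableEq A] in
theorem trace_traceFst [Fintype B] (X : Matrix (A × B) (A × B) ℂ) :
    (traceFst X).trace = X.trace := by
  simp only [traceFst, Matrix.trace, Fintype.sum_prod_type, Matrix.diag_apply, Matrix.of_apply]
  exact Finset.sum_comm

/-- A linear map that is constant on states is the trace times a constant. -/
theorem eq_trace_smul_of_const_on_states {V : Type*} [AddCommGroup V] [Module ℂ V]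
    (L : Matrix A A ℂ →ₗ[ℂ] V) {v : V} (h : ∀ ρ, IsState ρ → L ρ = v) (X : Matrix A A ℂ) :
    L X = X.trace • v := by
  have key : L = (Matrix.traceLinearMap A ℂ ℂ).smulRight v := by
    refine LinearMap.ext_on_range (v := ((↑) : {a : Matrix A A ℂ | 0 ≤ a} → Matrix A A ℂ))
      (by simpa using span_nonneg_matrix) ?_
    rintro ⟨P, hP⟩
    have hP' : P.PosSemidef := Matrix.nonneg_iff_posSemidef.1 hP
    simp only [LinearMap.smulRight_apply, Matrix.traceLinearMap_apply]
    -- Positive operators span; each is zero or a multiple of a state, according to its trace.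
    by_cases h0 : P.trace = 0
    · rw [h0, hP'.trace_eq_zero_iff.1 h0]
      simp
    · have hs : IsState (P.trace⁻¹ • P) :=
        ⟨hP'.smul (inv_nonneg.2 hP'.trace_nonneg), by simp [h0]⟩
      rw [← h _ hs, map_smul, smul_smul, mul_inv_cancel₀ h0, one_smul]
  rw [key]
  simp

end

section

/-! ### Simulations by no-signalling codes have bounded Choi matrix -/

variable {A B M : Type*} [Fintype A] [DecidableEq A] [Fintype M] [DecidableEq M]

omit [Fintype A] in
theorem choi_composeCode_id (P : Matrix (A × M) (A × M) ℂ →ₗ[ℂ] Matrix (M × B) (M × B) ℂ)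
    (i i' : A) (o o' : B) :
    choi (composeCode P LinearMap.id) (i, o) (i', o') =
      ∑ a, ∑ a', choi P ((i, a), (a, o)) ((i', a'), (a', o')) := by
  simp [choi, composeCode, Matrix.single_apply, ite_and, Matrix.single_kronecker_single]

theorem isState_one [Nonempty A] : IsState ((Fintype.card A : ℂ)⁻¹ • (1 : Matrix A A ℂ)) :=
  ⟨Matrix.PosSemidef.one.smul (by simp), by simp⟩

variable [Fintype B]

omit [DecidableEq M] in
-- No-signalling is assumed only for states; linearity extends it to matrix units, the inputs that
-- Choi matrices see.
theorem IsNSCode.traceFst_single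
    {P : Matrix (A × M) (A × M) ℂ →ₗ[ℂ] Matrix (M × B) (M × B) ℂ} (hP : IsNSCode P)
    {ρ : Matrix A A ℂ} (hρ : IsState ρ) (X : Matrix A A ℂ) (σ : Matrix M M ℂ) :
    traceFst (P (X ⊗ₖ σ)) = X.trace • traceFst (P (ρ ⊗ₖ σ)) := by
  let L : Matrix A A ℂ →ₗ[ℂ] Matrix B B ℂ :=
    { toFun := fun X => traceFst (P (X ⊗ₖ σ))
      map_add' := fun X Y => by
        ext
        simp [Matrix.add_kronecker, traceFst, Finset.sum_add_distrib]
      map_smul' := fun c X => by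
        ext
        simp [Matrix.smul_kronecker, traceFst, Finset.mul_sum] }
  exact eq_trace_smul_of_const_on_states L
    (fun ρ' hρ' => hP.noSignallingAliceToBob ρ' ρ σ hρ' hρ) X

omit [DecidableEq A] in
theorem IsNSCode.traceSnd_single
    {P : Matrix (A × M) (A × M) ℂ →ₗ[ℂ] Matrix (M × B) (M × B) ℂ} (hP : IsNSCode P)
    {ρ : Matrix M M ℂ} (hρ : IsState ρ) (σ : Matrix A A ℂ) (X : Matrix M M ℂ) :
    traceSnd (P (σ ⊗ₖ X)) = X.trace • traceSnd (P (σ ⊗ₖ ρ)) := by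
  let L : Matrix M M ℂ →ₗ[ℂ] Matrix M M ℂ :=
    { toFun := fun X => traceSnd (P (σ ⊗ₖ X))
      map_add' := fun X Y => by
        ext
        simp [Matrix.kronecker_add, traceSnd, Finset.sum_add_distrib]
      map_smul' := fun c X => by
        ext
        simp [Matrix.kronecker_smul, traceSnd, Finset.mul_sum] }
  exact eq_trace_smul_of_const_on_states L
    (fun ρ' hρ' => hP.noSignallingBobToAlice σ ρ' ρ hρ' hρ) X

theorem IsNSCode.isChannel_composeCode_id [Nonempty M]
    {P : Matrix (A × M) (A × M) ℂ →ₗ[ℂ] Matrix (M × B) (M × B) ℂ} (hP : IsNSCode P) :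
    IsChannel (composeCode P LinearMap.id) := by
  constructor
  · rw [← ofChoi_choi (composeCode P LinearMap.id)]
    refine isCompletelyPositive_ofChoi ?_
    convert posSemidef_sum_fibre hP.channel.completelyPositive.posSemidef_choi
      (fun (p : A × B) (a : M) => ((p.1, a), (a, p.2))) using 1
    ext ⟨i, o⟩ ⟨i', o'⟩
    exact choi_composeCode_id P i i' o o'
  · intro X
    -- By no-signalling from Bob to Alice, her marginal sees Bob's input only through its trace, so
    -- off-diagonal units vanish and all diagonal ones agree with the maximally mixed input.
    have h (a a' : M) : traceSnd (P (X ⊗ₖ Matrix.single a a' 1)) =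
        if a = a' then traceSnd (P (X ⊗ₖ ((Fintype.card M : ℂ)⁻¹ • (1 : Matrix M M ℂ)))) else 0 := by
      rw [hP.traceSnd_single isState_one]
      split_ifs with h
      · simp [h]
      · simp [h]
    have e (a a' : M) : ∑ o, P (X ⊗ₖ Matrix.single a a' 1) (a, o) (a', o) =
        traceSnd (P (X ⊗ₖ Matrix.single a a' 1)) a a' := rfl
    calc (composeCode P LinearMap.id X).trace
        = ∑ a, ∑ a', ∑ o, P (X ⊗ₖ Matrix.single a a' 1) (a, o) (a', o) := by
          simp only [Matrix.trace, Matrix.diag_apply, composeCode, LinearMap.coe_mk, AddHom.coe_mk,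
            Matrix.of_apply, LinearMap.id_apply]
          rw [Finset.sum_comm]
          refine Finset.sum_congr rfl fun a _ => ?_
          rw [Finset.sum_comm]
          refine Finset.sum_congr rfl fun a' _ => ?_
          simp [Matrix.single_apply, ite_and]
      _ = (traceSnd (P (X ⊗ₖ ((Fintype.card M : ℂ)⁻¹ • (1 : Matrix M M ℂ))))).trace := by
          have h' (a a' : M) (Y : Matrix M M ℂ) :
              (if a = a' then Y else 0) a a' = if a = a' then Y a a' else 0 := by
            split_ifs <;> rfl
          simp only [e, h, h']
          simp [Matrix.trace]
      _ = X.trace := by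
          rw [trace_traceSnd, hP.channel.tracePreserving, Matrix.trace_kronecker]
          simp

/-- The state `σ` is Bob's output on maximally mixed inputs. The looped Choi matrix is a double sum
over `a, a'`, bounded by `m` times its diagonal part; adding the terms where Bob's input differs
from Alice's output yields Bob's marginal, `m (1 ⊗ σ)`. -/
theorem IsNSCode.exists_choi_composeCode_id_le [Nonempty A] [Nonempty M]
    {P : Matrix (A × M) (A × M) ℂ →ₗ[ℂ] Matrix (M × B) (M × B) ℂ} (hP : IsNSCode P) :
    ∃ σ : Matrix B B ℂ, IsState σ ∧ choi (composeCode P LinearMap.id) ≤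
      ((Fintype.card M : ℝ) ^ 2) • ((1 : Matrix A A ℂ) ⊗ₖ σ) := by
  set ρ : Matrix A A ℂ := (Fintype.card A : ℂ)⁻¹ • 1 with hρdef
  set τ : Matrix M M ℂ := (Fintype.card M : ℂ)⁻¹ • 1 with hτdef
  have hρ : IsState ρ := isState_one
  have hτ : IsState τ := isState_one
  refine ⟨traceFst (P (ρ ⊗ₖ τ)), ⟨?_, ?_⟩, ?_⟩
  · exact posSemidef_sum_diag (hP.channel.completelyPositive.posSemidef_apply
      (hρ.posSemidef.kronecker hτ.posSemidef)) fun b a => (a, b)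
  · rw [trace_traceFst, hP.channel.tracePreserving, Matrix.trace_kronecker, hρ.trace_eq_one,
      hτ.trace_eq_one, one_mul]
  have hK := hP.channel.completelyPositive.posSemidef_choi
  have h1 := posSemidef_card_mul_sum_diag_sub hK
    (fun (p : A × B) (a : M) => ((p.1, a), (a, p.2)))
  -- The difference consists of the terms with `b ≠ a`, each a principal submatrix of `choi P`.
  have h2 : (Matrix.of fun p q : A × B => ∑ b : M, ∑ a : M,
      choi P ((p.1, b), (a, p.2)) ((q.1, b), (a, q.2)) -
      ∑ a : M, choi P ((p.1, a), (a, p.2)) ((q.1, a), (a, q.2))).PosSemidef := by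
    have := Matrix.posSemidef_sum Finset.univ fun b (_ : b ∈ Finset.univ) =>
      Matrix.posSemidef_sum Finset.univ fun a (_ : a ∈ Finset.univ) =>
        show (if b = a then 0 else
          (choi P).submatrix (fun p : A × B => ((p.1, b), (a, p.2)))
            fun p : A × B => ((p.1, b), (a, p.2))).PosSemidef by
          split_ifs
          · exact .zero
          · exact hK.submatrix _
    convert this using 1
    ext p q
    have h' (b a : M) (Y : Matrix (A × B) (A × B) ℂ) :
        (if b = a then 0 else Y) p q = Y p q - if b = a then Y p q else 0 := by
      split_ifs <;> simp
    simp [Matrix.sum_apply, h']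
  let L : Matrix M M ℂ →ₗ[ℂ] Matrix B B ℂ :=
    { toFun := fun X => traceFst (P (ρ ⊗ₖ X))
      map_add' := fun X Y => by
        ext
        simp [Matrix.kronecker_add, traceFst, Finset.sum_add_distrib]
      map_smul' := fun c X => by
        ext
        simp [Matrix.kronecker_smul, traceFst, Finset.mul_sum] }
  -- No-signalling replaces the unit at `(i, i')` by its trace times `ρ`, and the units at `(b, b)`
  -- sum to `1 = m τ`.
  have h3 (i i' : A) (o o' : B) : ∑ b : M, ∑ a : M, choi P ((i, b), (a, o)) ((i', b), (a, o')) =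
      Fintype.card M * ((1 : Matrix A A ℂ) ⊗ₖ traceFst (P (ρ ⊗ₖ τ))) (i, o) (i', o') := by
    calc _ = ∑ b : M, traceFst (P (Matrix.single i i' 1 ⊗ₖ Matrix.single b b 1)) o o' := by
          simp [choi, traceFst, Matrix.single_kronecker_single]
      _ = (Matrix.single i i' (1 : ℂ)).trace *
          ∑ b : M, traceFst (P (ρ ⊗ₖ Matrix.single b b 1)) o o' := by
          simp_rw [hP.traceFst_single hρ (Matrix.single i i' 1), Finset.mul_sum]
          rfl
      _ = (Matrix.single i i' (1 : ℂ)).trace * traceFst (P (ρ ⊗ₖ 1)) o o' := by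
          have h1 : (1 : Matrix M M ℂ) = ∑ b, Matrix.single b b 1 := by
            ext a a'
            simp [Matrix.sum_apply, Matrix.single_apply, Matrix.one_apply, ite_and]
          change _ = _ * L 1 o o'
          rw [h1, map_sum, Matrix.sum_apply]
          rfl
      _ = _ := by
          have h1 : (1 : Matrix M M ℂ) = (Fintype.card M : ℂ) • τ := by simp [hτdef]
          change _ * L 1 o o' = _ * (_ * L τ o o')
          rw [h1, map_smul]
          simp only [Matrix.smul_apply, smul_eq_mul, Matrix.one_apply]
          split_ifs with h
          · subst h
            simp
          · simp [Matrix.trace_single_eq_of_ne _ _ _ h]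
  suffices h : (((Fintype.card M : ℝ) ^ 2) • ((1 : Matrix A A ℂ) ⊗ₖ traceFst (P (ρ ⊗ₖ τ))) -
      choi (composeCode P LinearMap.id)).PosSemidef from h
  convert h1.add (h2.smul (show (0 : ℂ) ≤ Fintype.card M by simp)) using 1
  ext ⟨i, o⟩ ⟨i', o'⟩
  simp only [Matrix.sub_apply, Matrix.add_apply, Matrix.smul_apply, Matrix.of_apply,
    choi_composeCode_id, h3, smul_eq_mul, Complex.real_smul]
  push_cast
  ring

end

section

/-! ### Construction of no-signalling codes -/

section Entangled

variable (M : Type*) [Fintype M] [DecidableEq M]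

theorem maximallyEntangled_apply (p q : M × M) : maximallyEntangled M p q =
    if p.1 = p.2 then if q.1 = q.2 then (Fintype.card M : ℂ)⁻¹ else 0 else 0 := by
  obtain ⟨a, b⟩ := p
  obtain ⟨c, d⟩ := q
  simp only [maximallyEntangled, Matrix.smul_apply, Matrix.sum_apply, Matrix.single_apply,
    Prod.mk.injEq, smul_eq_mul]
  rw [Finset.sum_eq_single a, Finset.sum_eq_single c] <;> aesop

theorem posSemidef_maximallyEntangled : (maximallyEntangled M).PosSemidef := by
  convert (Matrix.posSemidef_vecMulVec_self_star
    (fun p : M × M => if p.1 = p.2 then (1 : ℂ) else 0)).smul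
    (show (0 : ℂ) ≤ (Fintype.card M : ℂ)⁻¹ by simp) using 1
  ext p q
  rw [maximallyEntangled_apply]
  by_cases h1 : p.1 = p.2 <;> by_cases h2 : q.1 = q.2 <;> simp [Matrix.vecMulVec_apply, h1, h2]

variable [Nonempty M]

theorem maximallyEntangled_mul_self :
    maximallyEntangled M * maximallyEntangled M = maximallyEntangled M := by
  have hm : (Fintype.card M : ℂ) ≠ 0 := by simp
  ext p q
  simp only [Matrix.mul_apply, maximallyEntangled_apply, Fintype.sum_prod_type]
  by_cases h1 : p.1 = p.2 <;> by_cases h2 : q.1 = q.2 <;> simp [h1, h2]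

/-- The complement of an orthogonal projection equals its own `Xᴴ X`. -/
theorem posSemidef_one_sub_maximallyEntangled : (1 - maximallyEntangled M).PosSemidef := by
  have h := Matrix.posSemidef_conjTranspose_mul_self (1 - maximallyEntangled M)
  rw [Matrix.conjTranspose_sub, Matrix.conjTranspose_one,
    (posSemidef_maximallyEntangled M).1.eq, mul_sub, sub_mul, sub_mul, maximallyEntangled_mul_self]
    at h
  simpa using h

end Entangled

variable {A B M : Type*} [Fintype A] [DecidableEq A] [Fintype M] [DecidableEq M] [Fintype B]

/-- A bipartite map which is no-signalling at the level of Choi matrices is a code. -/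
theorem isNSCode_ofChoi {J : Matrix ((A × M) × (M × B)) ((A × M) × (M × B)) ℂ} (hJ : J.PosSemidef)
    {σ : Matrix B B ℂ} (hσ : IsState σ) {τ : Matrix M M ℂ}
    (h₁ : ∀ i i' b b' o o', ∑ a, J ((i, b), (a, o)) ((i', b'), (a, o')) =
      if i = i' then if b = b' then σ o o' else 0 else 0)
    (h₂ : ∀ i i' b b' a a', ∑ o, J ((i, b), (a, o)) ((i', b'), (a', o)) =
      if i = i' then if b = b' then τ a a' else 0 else 0) :
    IsNSCode (ofChoi J) := by
  have e₁ (X : Matrix A A ℂ) (Y : Matrix M M ℂ) :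
      traceFst (ofChoi J (X ⊗ₖ Y)) = (X.trace * Y.trace) • σ := by
    ext o o'
    simp only [traceFst, ofChoi_apply, Matrix.of_apply]
    rw [Finset.sum_comm]
    simp_rw [Finset.sum_comm (s := (Finset.univ : Finset M)) (t := (Finset.univ : Finset (A × M))),
      ← Finset.mul_sum, Fintype.sum_prod_type, h₁]
    simp only [Finset.sum_ite_irrel, mul_ite, mul_zero, Finset.sum_const_zero, Finset.sum_ite_eq,
      Finset.mem_univ, if_true, Matrix.kroneckerMap_apply, Matrix.trace, Matrix.diag_apply,
      Matrix.smul_apply, smul_eq_mul]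
    rw [Finset.sum_mul_sum, Finset.sum_mul]
    simp only [Finset.sum_mul]
  have e₂ (X : Matrix A A ℂ) (Y : Matrix M M ℂ) :
      traceSnd (ofChoi J (X ⊗ₖ Y)) = (X.trace * Y.trace) • τ := by
    ext o o'
    simp only [traceSnd, ofChoi_apply, Matrix.of_apply]
    rw [Finset.sum_comm]
    simp_rw [Finset.sum_comm (s := (Finset.univ : Finset B)) (t := (Finset.univ : Finset (A × M))),
      ← Finset.mul_sum, Fintype.sum_prod_type, h₂]
    simp only [Finset.sum_ite_irrel, mul_ite, mul_zero, Finset.sum_const_zero, Finset.sum_ite_eq,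
      Finset.mem_univ, if_true, Matrix.kroneckerMap_apply, Matrix.trace, Matrix.diag_apply,
      Matrix.smul_apply, smul_eq_mul]
    rw [Finset.sum_mul_sum, Finset.sum_mul]
    simp only [Finset.sum_mul]
  refine ⟨isChannel_ofChoi hJ ?_, fun ρ₁ ρ₂ s hρ₁ hρ₂ => ?_, fun s ρ₁ ρ₂ hρ₁ hρ₂ => ?_⟩
  · ext ⟨i, b⟩ ⟨i', b'⟩
    simp only [traceSnd, Matrix.of_apply, Fintype.sum_prod_type]
    rw [Finset.sum_comm]
    simp_rw [h₁]
    have := hσ.trace_eq_one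
    simp only [Matrix.trace, Matrix.diag_apply] at this
    by_cases hi : i = i' <;> by_cases hb : b = b' <;> simp [hi, hb, Matrix.one_apply, this]
  · rw [e₁, e₁, hρ₁.trace_eq_one, hρ₂.trace_eq_one]
  · rw [e₂, e₂, hρ₁.trace_eq_one, hρ₂.trace_eq_one]

/-- With `Φ` the maximally entangled state on Bob's input and Alice's output, the code has Choi
matrix `Φ ⊗ E + (1 - Φ) ⊗ F`. The partial traces of `Φ` and `1 - Φ` over Alice's output are `1/m`
and `m - 1/m` times the identity, so `h` is no-signalling to Bob; equal marginals of `E` and `F`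
give no-signalling to Alice. Closing the loop pairs `Φ` to `m` and `1 - Φ` to `0`. -/
theorem exists_isNSCode_of_decomposition [Nonempty M] {E F : Matrix (A × B) (A × B) ℂ}
    (hE : E.PosSemidef) (hF : F.PosSemidef)
    (hE' : traceSnd E = (Fintype.card M : ℂ)⁻¹ • 1) (hF' : traceSnd F = (Fintype.card M : ℂ)⁻¹ • 1)
    {σ : Matrix B B ℂ} (hσ : IsState σ)
    (h : (Fintype.card M : ℂ)⁻¹ • E + ((Fintype.card M : ℂ) - (Fintype.card M : ℂ)⁻¹) • F =
      1 ⊗ₖ σ) :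
    ∃ P : Matrix (A × M) (A × M) ℂ →ₗ[ℂ] Matrix (M × B) (M × B) ℂ, IsNSCode P ∧
      composeCode P LinearMap.id = ofChoi ((Fintype.card M : ℂ) • E) := by
  have hm : (Fintype.card M : ℂ) ≠ 0 := by simp
  let r : (A × M) × (M × B) → (M × M) × (A × B) := fun p => ((p.1.2, p.2.1), (p.1.1, p.2.2))
  let J := (maximallyEntangled M ⊗ₖ E + (1 - maximallyEntangled M) ⊗ₖ F).submatrix r r
  have hJ : J.PosSemidef :=
    (((posSemidef_maximallyEntangled M).kronecker hE).add
      ((posSemidef_one_sub_maximallyEntangled M).kronecker hF)).submatrix r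
  have J_apply (i i' b b' a a' o o') : J ((i, b), (a, o)) ((i', b'), (a', o')) =
      maximallyEntangled M (b, a) (b', a') * E (i, o) (i', o') +
        ((if b = b' then if a = a' then 1 else 0 else 0) - maximallyEntangled M (b, a) (b', a')) *
          F (i, o) (i', o') := by
    simp [J, r, Matrix.one_apply, ite_and]
  refine ⟨ofChoi J, isNSCode_ofChoi hJ hσ (τ := (Fintype.card M : ℂ)⁻¹ • 1) ?_ ?_, ?_⟩
  · intro i i' b b' o o'
    have h' := congrFun (congrFun h (i, o)) (i', o')
    simp only [Matrix.add_apply, Matrix.smul_apply, smul_eq_mul, Matrix.kroneckerMap_apply,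
      Matrix.one_apply, ite_mul, one_mul, zero_mul] at h'
    have s : ∑ a, maximallyEntangled M (b, a) (b', a) =
        if b = b' then (Fintype.card M : ℂ)⁻¹ else 0 := by
      simp [maximallyEntangled_apply, eq_comm]
    simp_rw [J_apply]
    rw [Finset.sum_add_distrib, ← Finset.sum_mul, ← Finset.sum_mul, Finset.sum_sub_distrib, s]
    by_cases hb : b = b'
    · simpa [hb] using h'
    · simp [hb]
  · intro i i' b b' a a'
    have hE₁ : ∑ o, E (i, o) (i', o) = if i = i' then (Fintype.card M : ℂ)⁻¹ else 0 := by
      simpa [traceSnd, Matrix.one_apply] using congrFun (congrFun hE' i) i'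
    have hF₁ : ∑ o, F (i, o) (i', o) = if i = i' then (Fintype.card M : ℂ)⁻¹ else 0 := by
      simpa [traceSnd, Matrix.one_apply] using congrFun (congrFun hF' i) i'
    simp_rw [J_apply]
    rw [Finset.sum_add_distrib, ← Finset.mul_sum, ← Finset.mul_sum, hE₁, hF₁]
    by_cases hi : i = i' <;> by_cases hb : b = b' <;> by_cases ha : a = a' <;>
      simp [hi, hb, ha, sub_mul]
  · rw [← ofChoi_choi (composeCode (ofChoi J) LinearMap.id)]
    congr 1
    ext ⟨i, o⟩ ⟨i', o'⟩
    rw [choi_composeCode_id, choi_ofChoi]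
    simp_rw [J_apply]
    simp only [maximallyEntangled_apply, if_true, Finset.sum_add_distrib, ← Finset.sum_mul,
      Finset.sum_sub_distrib]
    simp [hm, sub_self]

theorem exists_isNSCode_composeCode_id_eq [Nonempty M] {J : Matrix (A × B) (A × B) ℂ}
    (hJ : J.PosSemidef) (hJ' : traceSnd J = 1) {σ : Matrix B B ℂ} (hσ : IsState σ)
    (h : J ≤ ((Fintype.card M : ℝ) ^ 2) • ((1 : Matrix A A ℂ) ⊗ₖ σ)) :
    ∃ P : Matrix (A × M) (A × M) ℂ →ₗ[ℂ] Matrix (M × B) (M × B) ℂ, IsNSCode P ∧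
      composeCode P LinearMap.id = ofChoi J := by
  set m := Fintype.card M
  have hm : (m : ℂ) ≠ 0 := by simp [m]
  have hm1 : 1 ≤ m := Fintype.card_pos
  have h' : (((m : ℝ) ^ 2) • ((1 : Matrix A A ℂ) ⊗ₖ σ) - J).PosSemidef := h
  have hσ' (c : ℂ) : traceSnd (c • ((1 : Matrix A A ℂ) ⊗ₖ σ)) = c • 1 := by
    ext i i'
    have := hσ.trace_eq_one
    simp only [Matrix.trace, Matrix.diag_apply] at this
    change ∑ o, c * ((1 : Matrix A A ℂ) i i' * σ o o) = c * (1 : Matrix A A ℂ) i i'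
    rw [← Finset.mul_sum, ← Finset.mul_sum, this, mul_one]
  obtain ⟨F, hF, hF₁, hF₂⟩ : ∃ F : Matrix (A × B) (A × B) ℂ, F.PosSemidef ∧
      traceSnd F = (m : ℂ)⁻¹ • 1 ∧
      (m : ℂ)⁻¹ • ((m : ℂ)⁻¹ • J) + ((m : ℂ) - (m : ℂ)⁻¹) • F = 1 ⊗ₖ σ := by
    -- For `m = 1` the coefficient of `F` vanishes and `F` cannot be solved for; but then `J ≤ 1 ⊗
    -- σ` with equal traces forces equality, and any `F` with the right marginal serves. Otherwise
    -- `F` is determined by the required identity.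
    rcases hm1.eq_or_lt with h1 | h1
    · have hc : (m : ℂ) = 1 := by simp [← h1]
      have hr : (m : ℝ) = 1 := by simp [← h1]
      refine ⟨1 ⊗ₖ σ, Matrix.PosSemidef.one.kronecker hσ.posSemidef, by simpa [hc] using hσ' 1, ?_⟩
      have h0 := h'.trace_eq_zero_iff.1 (by
        rw [Matrix.trace_sub, hr, one_pow, one_smul, ← trace_traceSnd J, hJ',
          Matrix.trace_kronecker, hσ.trace_eq_one]
        simp)
      rw [hr, one_pow, one_smul, sub_eq_zero] at h0
      simp [hc, h0]
    · have hd : (0 : ℝ) < (m : ℝ) ^ 2 - 1 := by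
        have : (1 : ℝ) < m := by exact_mod_cast h1
        nlinarith
      have hd' : (m : ℂ) ^ 2 - 1 ≠ 0 := by exact_mod_cast hd.ne'
      have hc : (0 : ℝ) ≤ ((m : ℝ) * ((m : ℝ) ^ 2 - 1))⁻¹ := by positivity
      refine ⟨((m : ℂ) * ((m : ℂ) ^ 2 - 1))⁻¹ • ((m : ℂ) ^ 2 • ((1 : Matrix A A ℂ) ⊗ₖ σ) - J),
        ?_, ?_, ?_⟩
      · convert h'.smul (show (0 : ℂ) ≤ (((m : ℝ) * ((m : ℝ) ^ 2 - 1))⁻¹ : ℝ) by exact_mod_cast hc)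
          using 1
        ext
        simp
      · have e (c d : ℂ) (X Y : Matrix (A × B) (A × B) ℂ) : traceSnd (c • (d • X - Y)) =
            c • (traceSnd (d • X) - traceSnd Y) := by
          ext
          simp [traceSnd, ← Finset.mul_sum]
        rw [e, hσ', hJ']
        ext i i'
        simp only [Matrix.smul_apply, Matrix.sub_apply, smul_eq_mul]
        field_simp
      · ext p q
        simp only [Matrix.add_apply, Matrix.smul_apply, Matrix.sub_apply, smul_eq_mul]
        field_simp
        ring
  obtain ⟨P, hP, hP'⟩ := exists_isNSCode_of_decomposition (M := M) (E := (m : ℂ)⁻¹ • J)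
    (hJ.smul (by simp)) hF (by
      ext i i'
      simpa [traceSnd, ← Finset.mul_sum, m] using congrFun (congrFun hJ' i) i') hF₁ hσ hF₂
  refine ⟨P, hP, ?_⟩
  rw [hP', smul_smul, mul_inv_cancel₀ hm, one_smul]

end

section

/-! ### Compactness -/

variable {A B : Type*} [Fintype A] [DecidableEq A] [Fintype B] [DecidableEq B]

/-- The Choi matrices of channels within diamond distance `c` of `N` which are dominated by
`t • (1 ⊗ σ)` for a state `σ`, together with `σ`. -/
def approximants (N : Matrix A A ℂ →ₗ[ℂ] Matrix B B ℂ) (t : ℝ) (c : ℝ≥0∞) :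
    Set (Matrix (A × B) (A × B) ℂ × Matrix B B ℂ) :=
  {p | p.1.PosSemidef ∧ traceSnd p.1 = 1 ∧ IsState p.2 ∧
    p.1 ≤ t • ((1 : Matrix A A ℂ) ⊗ₖ p.2) ∧ diamondNorm (ofChoi p.1 - N) ≤ c}

theorem approximants_mono (N : Matrix A A ℂ →ₗ[ℂ] Matrix B B ℂ) {t t' : ℝ} {c c' : ℝ≥0∞}
    (ht : t ≤ t') (hc : c ≤ c') : approximants N t c ⊆ approximants N t' c' := by
  rintro p ⟨h1, h2, h3, h4, h5⟩
  refine ⟨h1, h2, h3, h4.trans ?_, h5.trans hc⟩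
  suffices h : (t' • ((1 : Matrix A A ℂ) ⊗ₖ p.2) - t • ((1 : Matrix A A ℂ) ⊗ₖ p.2)).PosSemidef from h
  rw [← sub_smul]
  exact (Matrix.PosSemidef.one.kronecker h3.posSemidef).smul (sub_nonneg.2 ht)

theorem isClosed_diamondNorm_le (N : Matrix A A ℂ →ₗ[ℂ] Matrix B B ℂ) (c : ℝ≥0∞) :
    IsClosed {J : Matrix (A × B) (A × B) ℂ | diamondNorm (ofChoi J - N) ≤ c} := by
  simp only [diamondNorm, iSup_le_iff, Set.ofPred_forall]
  refine isClosed_iInter fun k => isClosed_iInter fun X => isClosed_iInter fun _ => ?_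
  refine isClosed_le (ENNReal.continuous_ofReal.comp (continuous_traceNorm.comp ?_))
    continuous_const
  simp only [applyWithReference_sub]
  refine Continuous.sub ?_ continuous_const
  refine continuous_matrix fun p q => ?_
  simp only [applyWithReference, Matrix.of_apply, ofChoi_apply]
  fun_prop

theorem isClosed_approximants (N : Matrix A A ℂ →ₗ[ℂ] Matrix B B ℂ) (t : ℝ) (c : ℝ≥0∞) :
    IsClosed (approximants N t c) := by
  refine .inter (isClosed_posSemidef.preimage continuous_fst) (.inter ?_ (.inter ?_ (.inter ?_
    ((isClosed_diamondNorm_le N c).preimage continuous_fst))))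
  · refine isClosed_eq (continuous_matrix fun a a' => ?_) continuous_const
    simp only [traceSnd, Matrix.of_apply]
    fun_prop
  · have : {σ : Matrix B B ℂ | IsState σ} = {σ | σ.PosSemidef ∧ σ.trace = 1} :=
      Set.ext fun σ => ⟨fun h => ⟨h.1, h.2⟩, fun h => ⟨h.1, h.2⟩⟩
    refine IsClosed.preimage (f := Prod.snd) (t := {σ : Matrix B B ℂ | IsState σ}) continuous_snd ?_
    rw [this]
    exact (isCompact_posSemidef_trace_eq 1).isClosed
  · refine isClosed_posSemidef.preimage (f := fun p : Matrix (A × B) (A × B) ℂ × Matrix B B ℂ =>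
      t • ((1 : Matrix A A ℂ) ⊗ₖ p.2) - p.1) (continuous_matrix fun x y => ?_)
    simp only [Matrix.sub_apply, Matrix.smul_apply, Matrix.kroneckerMap_apply]
    fun_prop

theorem isCompact_approximants (N : Matrix A A ℂ →ₗ[ℂ] Matrix B B ℂ) (t : ℝ) (c : ℝ≥0∞) :
    IsCompact (approximants N t c) := by
  refine ((isCompact_posSemidef_trace_eq (A := A × B) (Fintype.card A : ℂ)).prod
    (isCompact_posSemidef_trace_eq (A := B) 1)).of_isClosed_subset (isClosed_approximants N t c) ?_
  rintro p ⟨h1, h2, h3, -, -⟩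
  -- Trace preservation fixes the trace of the Choi matrix at `|A|`, which bounds it.
  exact ⟨⟨h1, by rw [← trace_traceSnd, h2, Matrix.trace_one]⟩, h3.1, h3.2⟩

/-- Nested nonempty compact sets share a point, whose closed constraints survive the limit. This
makes the infima over codes, channels and states attained. -/
theorem approximants_nonempty_of_forall (N : Matrix A A ℂ →ₗ[ℂ] Matrix B B ℂ) (t : ℝ) {c : ℝ≥0∞}
    (h : ∀ δ : ℝ≥0, 0 < δ → (approximants N (t + δ) (c + δ)).Nonempty) :
    (approximants N t c).Nonempty := by
  obtain ⟨u, hu, hu0, hu'⟩ := exists_seq_strictAnti_tendsto (0 : ℝ≥0)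
  obtain ⟨p, hp⟩ := IsCompact.nonempty_iInter_of_sequence_nonempty_isCompact_isClosed
    (fun n => approximants N (t + u n) (c + u n))
    (fun n => approximants_mono N (by gcongr; exact hu.antitone n.le_succ)
      (by gcongr; exact hu.antitone n.le_succ))
    (fun n => h _ (hu0 n)) (isCompact_approximants N _ _) (fun n => isClosed_approximants N _ _)
  rw [Set.mem_iInter] at hp
  refine ⟨p, (hp 0).1, (hp 0).2.1, (hp 0).2.2.1, ?_, ?_⟩
  · have h1 : Filter.Tendsto (fun n => (t + u n) • ((1 : Matrix A A ℂ) ⊗ₖ p.2) - p.1) Filter.atTop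
        (nhds ((t + (0 : ℝ≥0)) • ((1 : Matrix A A ℂ) ⊗ₖ p.2) - p.1)) :=
      ((((NNReal.tendsto_coe.2 hu').const_add t)).smul_const _).sub_const _
    have h2 := isClosed_posSemidef.mem_of_tendsto h1 (.of_forall fun n => (hp n).2.2.2.1)
    rw [NNReal.coe_zero, add_zero] at h2
    exact h2
  · have h1 : Filter.Tendsto (fun n => c + (u n : ℝ≥0∞)) Filter.atTop (nhds (c + (0 : ℝ≥0))) :=
      (ENNReal.tendsto_coe.2 hu').const_add c
    simpa using ge_of_tendsto' h1 fun n => (hp n).2.2.2.2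

/-! ### The simulation error and the smooth max-information -/

theorem half_mul_le_iff {x : ℝ≥0∞} {y : ℝ≥0∞} : 1 / 2 * x ≤ y ↔ x ≤ 2 * y := by
  rw [one_div, ENNReal.inv_mul_le_iff (by simp) (by simp)]

theorem simulationErrorNS_id_le_iff [Nonempty A] (N : Matrix A A ℂ →ₗ[ℂ] Matrix B B ℂ) (ε : ℝ≥0)
    {m : ℕ} (hm : 1 ≤ m) :
    simulationErrorNS (LinearMap.id : Matrix (Fin m) (Fin m) ℂ →ₗ[ℂ] Matrix (Fin m) (Fin m) ℂ) N
      ≤ (ε : ℝ≥0∞) ↔ (approximants N ((m : ℝ) ^ 2) (2 * ε)).Nonempty := by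
  have : Nonempty (Fin m) := ⟨⟨0, hm⟩⟩
  rw [simulationErrorNS, half_mul_le_iff]
  constructor
  · intro h
    refine approximants_nonempty_of_forall N _ fun δ hδ => ?_
    have h' := h.trans_lt (ENNReal.lt_add_right (ENNReal.mul_ne_top ENNReal.ofNat_ne_top
      ENNReal.coe_ne_top) (ENNReal.coe_ne_zero.2 hδ.ne'))
    simp only [iInf_lt_iff] at h'
    obtain ⟨P, hP, hlt⟩ := h'
    obtain ⟨σ, hσ, hle⟩ := hP.exists_choi_composeCode_id_le
    have hc := hP.isChannel_composeCode_id
    refine Set.Nonempty.mono (approximants_mono N (t := (m : ℝ) ^ 2) (by simp) le_rfl)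
      ⟨(choi (composeCode P LinearMap.id), σ), hc.completelyPositive.posSemidef_choi,
        isTracePreserving_iff.1 hc.tracePreserving, hσ, by simpa using hle, ?_⟩
    rw [ofChoi_choi]
    exact hlt.le
  · rintro ⟨⟨J, σ⟩, hJ, hJ', hσ, hle, hd⟩
    obtain ⟨P, hP, hP'⟩ := exists_isNSCode_composeCode_id_eq (M := Fin m) hJ hJ' hσ
      (by simpa using hle)
    refine iInf₂_le_of_le P hP ?_
    rwa [hP']

omit [DecidableEq B] in
-- The Choi state has marginal `1/|A|` on `A`, so the normalisation cancels on both sides.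
theorem le_smul_traceSnd_kronecker_iff [Nonempty A] {N : Matrix A A ℂ →ₗ[ℂ] Matrix B B ℂ}
    (hN : IsTracePreserving N) {σ : Matrix B B ℂ} {t : ℝ} :
    applyWithReference A N (maximallyEntangled A) ≤ ((2 : ℝ) ^ t) •
      (traceSnd (applyWithReference A N (maximallyEntangled A)) ⊗ₖ σ) ↔
      choi N ≤ ((2 : ℝ) ^ t) • ((1 : Matrix A A ℂ) ⊗ₖ σ) := by
  have hA : (0 : ℝ) < Fintype.card A := by exact_mod_cast Fintype.card_pos
  have h1 : traceSnd ((Fintype.card A : ℂ)⁻¹ • choi N) = (Fintype.card A : ℂ)⁻¹ • 1 := by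
    rw [← isTracePreserving_iff.1 hN]
    ext
    simp [traceSnd, Finset.mul_sum]
  rw [applyWithReference_maximallyEntangled, h1, Matrix.smul_kronecker, smul_comm]
  have h2 : ((Fintype.card A : ℂ)⁻¹ • ((2 : ℝ) ^ t • ((1 : Matrix A A ℂ) ⊗ₖ σ))) -
      (Fintype.card A : ℂ)⁻¹ • choi N =
      (Fintype.card A : ℝ)⁻¹ • ((2 : ℝ) ^ t • ((1 : Matrix A A ℂ) ⊗ₖ σ) - choi N) := by
    ext
    simp [mul_sub]
  rw [Matrix.le_iff, Matrix.le_iff, h2]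
  refine ⟨fun h => ?_, fun h => h.smul (inv_nonneg.2 hA.le)⟩
  simpa [smul_smul, hA.ne'] using h.smul hA.le

theorem smoothChannelMaxInformation_le_iff [Nonempty A] (N : Matrix A A ℂ →ₗ[ℂ] Matrix B B ℂ)
    (ε : ℝ≥0) (s : ℝ) : smoothChannelMaxInformation ε N ≤ s ↔
      (approximants N ((2 : ℝ) ^ s) (2 * ε)).Nonempty := by
  constructor
  · intro h
    refine approximants_nonempty_of_forall N _ fun δ hδ => ?_
    have hpos : (0 : ℝ) < 2 ^ s := by positivity
    have hδ' : (0 : ℝ) < δ := hδ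
    -- The additive slack `δ` on `2 ^ s` becomes strict room above `s`, from which a near-optimal
    -- channel, state and exponent can be drawn.
    have hs : s < Real.logb 2 (2 ^ s + δ) := by
      rw [Real.lt_logb_iff_rpow_lt (by norm_num) (by positivity)]
      linarith
    have h' := h.trans_lt (EReal.coe_lt_coe_iff.2 hs)
    simp only [smoothChannelMaxInformation, channelMaxInformation, maxInformation,
      maxRelativeEntropy, iInf_lt_iff] at h'
    obtain ⟨N', ⟨hN', hd⟩, σ, hσ, t, ht, hlt⟩ := h'
    rw [le_smul_traceSnd_kronecker_iff hN'.tracePreserving] at ht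
    refine Set.Nonempty.mono (approximants_mono N (t := (2 : ℝ) ^ t) (c := 2 * ε) ?_ (by simp))
      ⟨(choi N', σ), hN'.completelyPositive.posSemidef_choi,
        isTracePreserving_iff.1 hN'.tracePreserving, hσ, ht, ?_⟩
    · rw [EReal.coe_lt_coe_iff, Real.lt_logb_iff_rpow_lt (by norm_num) (by positivity)] at hlt
      exact hlt.le
    · rw [ofChoi_choi]
      exact half_mul_le_iff.1 hd
  · rintro ⟨⟨J, σ⟩, hJ, hJ', hσ, hle, hd⟩
    have hc := isChannel_ofChoi hJ hJ'
    refine iInf₂_le_of_le (ofChoi J) ⟨hc, half_mul_le_iff.2 hd⟩ (iInf₂_le_of_le σ hσ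
      (iInf₂_le_of_le s ?_ le_rfl))
    rw [le_smul_traceSnd_kronecker_iff hc.tracePreserving, choi_ofChoi]
    exact hle

/-! ### Finiteness and nonnegativity of the smooth max-information -/

theorem traceNorm_zero : traceNorm (0 : Matrix A A ℂ) = 0 := by
  simp [traceNorm]

theorem diamondNorm_zero : diamondNorm (0 : Matrix A A ℂ →ₗ[ℂ] Matrix B B ℂ) = 0 := by
  have (k : ℕ) (X : Matrix (Fin k × A) (Fin k × A) ℂ) :
      applyWithReference (Fin k) (0 : Matrix A A ℂ →ₗ[ℂ] Matrix B B ℂ) X = 0 := rfl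
  simp [diamondNorm, this, traceNorm_zero]

omit [DecidableEq B] in
theorem IsChannel.nonempty [Nonempty A] {N : Matrix A A ℂ →ₗ[ℂ] Matrix B B ℂ} (hN : IsChannel N) :
    Nonempty B := by
  by_contra h
  rw [not_nonempty_iff] at h
  have := hN.tracePreserving 1
  simp [Matrix.trace, eq_comm] at this

/-- Every channel lies in some set of approximants of itself. -/
theorem exists_approximants_nonempty [Nonempty A] {N : Matrix A A ℂ →ₗ[ℂ] Matrix B B ℂ}
    (hN : IsChannel N) (c : ℝ≥0∞) : ∃ s : ℝ, (approximants N ((2 : ℝ) ^ s) c).Nonempty := by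
  have := hN.nonempty
  have hJ := hN.completelyPositive.posSemidef_choi
  have hJ' := isTracePreserving_iff.1 hN.tracePreserving
  have hA : (0 : ℝ) < Fintype.card A := by exact_mod_cast Fintype.card_pos
  have hB : (0 : ℝ) < Fintype.card B := by exact_mod_cast Fintype.card_pos
  -- With `σ` maximally mixed, `J ≤ (tr J) 1 = |A| 1 = |A| |B| (1 ⊗ σ)`.
  refine ⟨Real.logb 2 (Fintype.card A * Fintype.card B),
    (choi N, (Fintype.card B : ℂ)⁻¹ • 1), hJ, hJ', isState_one, ?_, ?_⟩
  · rw [Real.rpow_logb (by norm_num) (by norm_num) (by positivity)]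
    convert le_algebraMap_trace hJ using 1
    rw [← trace_traceSnd, hJ', Matrix.trace_one, Matrix.kronecker_smul, Matrix.one_kronecker_one,
      Algebra.algebraMap_eq_smul_one]
    rw [show (Fintype.card B : ℂ)⁻¹ • (1 : Matrix (A × B) (A × B) ℂ) =
      (Fintype.card B : ℝ)⁻¹ • 1 by ext; simp, smul_smul, mul_inv_cancel_right₀ hB.ne',
      Complex.natCast_re]
  · rw [ofChoi_choi, sub_self, diamondNorm_zero]
    exact zero_le

/-- Traces of the domination give `|A| ≤ t |A|`. -/
theorem one_le_of_approximants_nonempty [Nonempty A] {N : Matrix A A ℂ →ₗ[ℂ] Matrix B B ℂ}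
    {t : ℝ} {c : ℝ≥0∞} (h : (approximants N t c).Nonempty) : 1 ≤ t := by
  obtain ⟨⟨J, σ⟩, hJ, hJ', hσ, hle, hd⟩ := h
  have hA : (0 : ℝ) < Fintype.card A := by exact_mod_cast Fintype.card_pos
  have h' : (t • ((1 : Matrix A A ℂ) ⊗ₖ σ) - J).PosSemidef := hle
  have h2 := (Complex.nonneg_iff.1 h'.trace_nonneg).1
  rw [Matrix.trace_sub, Matrix.trace_smul, Matrix.trace_kronecker, hσ.trace_eq_one,
    ← trace_traceSnd J, hJ', Matrix.trace_one] at h2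
  simp at h2
  nlinarith

theorem log2_natCast {n : ℕ} (hn : 1 ≤ n) : log2 (n : ℝ≥0∞) = (Real.logb 2 n : ℝ) := by
  rw [log2, ENNReal.log_pos_real (by simpa using by omega) (by simp), ← EReal.coe_div]
  simp [Real.logb]

end

end

end QuantumSimulation

/-! ### Rounding to an integer dimension -/

open QuantumSimulation in
theorem theorem1 {A B : Type*} [Fintype A] [DecidableEq A] [Nonempty A]
    [Fintype B] [DecidableEq B]
    (N : Matrix A A ℂ →ₗ[ℂ] Matrix B B ℂ) (hN : QuantumSimulation.IsChannel N) (ε : NNReal) :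
    ∃ δ : ℝ,
      IsLeast {d : ℝ | d ∈ Set.Icc (0 : ℝ) 1 ∧ ∃ n : ℕ, 1 ≤ n ∧
        ((1 / 2 : ℝ) : EReal) * QuantumSimulation.smoothChannelMaxInformation ε N + (d : EReal) =
          QuantumSimulation.log2 (n : ENNReal)} δ ∧
      QuantumSimulation.simulationCostNS ε N =
        ((1 / 2 : ℝ) : EReal) * QuantumSimulation.smoothChannelMaxInformation ε N +
          (δ : EReal) := by
  have hiff := smoothChannelMaxInformation_le_iff N ε
  obtain ⟨r, hr⟩ : ∃ r : ℝ, smoothChannelMaxInformation ε N = r := by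
    obtain ⟨s, hs⟩ := exists_approximants_nonempty hN (2 * ε)
    have htop : smoothChannelMaxInformation ε N ≠ ⊤ :=
      (((hiff s).2 hs).trans_lt (EReal.coe_lt_top s)).ne
    have hbot : smoothChannelMaxInformation ε N ≠ ⊥ := by
      intro h
      -- Any negative exponent would do; `-1` gives the contradiction `1 ≤ 1/2`.
      have h1 := one_le_of_approximants_nonempty ((hiff (-1)).1 (by simp [h]))
      norm_num [Real.rpow_neg_one] at h1
    exact ⟨_, (EReal.coe_toReal htop hbot).symm⟩
  rw [hr]
  simp only [hr, EReal.coe_le_coe_iff] at hiff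
  have hr0 : 0 ≤ r := by
    have h1 := one_le_of_approximants_nonempty ((hiff r).1 le_rfl)
    by_contra! h
    exact absurd (Real.rpow_lt_one_of_one_lt_of_neg one_lt_two h) (not_lt.2 h1)
  -- The real threshold for feasible dimensions: `2 ^ r ≤ m²` means `x ≤ m`.
  set x : ℝ := 2 ^ (r / 2) with hx
  have hx1 : 1 ≤ x := Real.one_le_rpow one_le_two (by positivity)
  have hx0 : 0 < x := by positivity
  have hlogx : Real.logb 2 x = r / 2 := Real.logb_rpow (by norm_num) (by norm_num)
  have hle {n : ℕ} (hn : 1 ≤ n) : x ≤ n ↔ r / 2 ≤ Real.logb 2 n := by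
    rw [hx, Real.le_logb_iff_rpow_le one_lt_two (by exact_mod_cast hn)]
  have hsim {m : ℕ} (hm : 1 ≤ m) : simulationErrorNS
      (LinearMap.id : Matrix (Fin m) (Fin m) ℂ →ₗ[ℂ] Matrix (Fin m) (Fin m) ℂ) N ≤ (ε : ENNReal) ↔
      x ≤ m := by
    have hm0 : (0 : ℝ) < m := by exact_mod_cast hm
    rw [simulationErrorNS_id_le_iff N ε hm, hle hm, div_le_iff₀' two_pos, hiff]
    congr! 2
    rw [mul_comm, Real.rpow_mul two_pos.le, Real.rpow_logb two_pos (by norm_num) hm0]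
    norm_cast
  have hceil : 1 ≤ ⌈x⌉₊ := Nat.one_le_ceil_iff.2 hx0
  have hcost : simulationCostNS ε N = (Real.logb 2 ⌈x⌉₊ : ℝ) := by
    rw [← log2_natCast hceil, simulationCostNS]
    congr 1
    refine le_antisymm (iInf₂_le _ ⟨hceil, (hsim hceil).2 (Nat.le_ceil x)⟩) (le_iInf₂ fun m hm => ?_)
    exact_mod_cast Nat.ceil_le.2 ((hsim hm.1).1 hm.2)
  have hadd (d : ℝ) : ((1 / 2 : ℝ) : EReal) * (r : EReal) + (d : EReal) =
      ((r / 2 + d : ℝ) : EReal) := by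
    rw [← EReal.coe_mul, ← EReal.coe_add]
    congr 1
    ring
  refine ⟨Real.logb 2 ⌈x⌉₊ - r / 2, ⟨⟨⟨?_, ?_⟩, ⌈x⌉₊, hceil, ?_⟩, ?_⟩, ?_⟩
  · exact sub_nonneg.2 ((hle hceil).1 (Nat.le_ceil x))
  -- The ceiling is below `x + 1`, and `1 ≤ x`.
  · have h1 : (⌈x⌉₊ : ℝ) ≤ 2 * x := by linarith [Nat.ceil_lt_add_one hx0.le]
    have h2 := Real.logb_le_logb_of_le one_lt_two (by exact_mod_cast hceil) h1
    rw [Real.logb_mul two_ne_zero hx0.ne', hlogx, Real.logb_self_eq_one one_lt_two] at h2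
    linarith
  · rw [hadd, log2_natCast hceil]
    simp
  · rintro d ⟨⟨hd, -⟩, n, hn, h⟩
    rw [hadd, log2_natCast hn, EReal.coe_eq_coe_iff] at h
    -- A competitor `d ≥ 0` puts `n` at or above `x`, hence at or above its ceiling.
    have h1 : ⌈x⌉₊ ≤ n := Nat.ceil_le.2 ((hle hn).2 (by linarith))
    have h2 := Real.logb_le_logb_of_le one_lt_two (by exact_mod_cast hceil)
      (show (⌈x⌉₊ : ℝ) ≤ n by exact_mod_cast h1)
    linarith
  · rw [hadd, hcost]
    simp
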